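/- Let $\mathcal H$ and $\mathcal K$ be finite-dimensional complex Hilbert spaces, $\mathcal H\neq 0$, and let $C_0,C_1$ be two nonempty compact convex sets of quantum channels (completely positive trace-preserving linear maps) from $L(\mathcal H)$ to $L(\mathcal K)$. Write $\|X\|_1=\operatorname{Tr}\sqrt{X^\dagger X}$ and $\|\Phi\|_\diamond=\sup_{k\ge 1}\,\sup_{\|X\|_1\le 1}\|(\Phi\otimes \mathrm{id}_{L(\mathbb C^k)})(X)\|_1$, where $X$ ranges over $L(\mathcal H\otimes\mathbb C^k)$. Define the operational distance $$\widetilde D(C_0,C_1)=\sup_{\rho}\ \min_{\Phi_0\in C_0,\ \Phi_1\in C_1}\big\|(\Phi_0\otimes\mathrm{id}_{L(\mathcal H')})(\rho)-(\Phi_1\otimes\mathrm{id}_{L(\mathcal H')})(\rho)\big\|_1,$$ where the supremum is over all density operators $\rho$ on $\mathcal H\otimes\mathcal H'$ with $\mathcal H'$ an auxiliary Hilbert space of arbitrary finite dimension, and the ordinary distance $$D(C_0,C_1)=\min_{\Phi_0\in C_0,\ \Phi_1\in C_1}\|\Phi_0-\Phi_1\|_\diamond .$$ Then these minima are attained, the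 suprema (including those defining $\|\Phi_0-\Phi_1\|_\diamond$ for $\Phi_i\in C_i$) are finite, and $$\widetilde D(C_0,C_1)=D(C_0,C_1).$$ -/

import Mathlib

open scoped Kronecker ComplexOrder MatrixOrder

namespace ChannelDistance

/-- Super-operators `L(H) → L(K)`, where `H = ℂ^m` and `K = ℂ^n` for finite index types `m`, `n`,
so that linear operators are complex square matrices. -/
abbrev SuperOp (m n : Type*) : Type _ := Matrix m m ℂ →ₗ[ℂ] Matrix n n ℂ

/-- The usual topology on the space of super-operators (a finite-dimensional complex vector space
when `m` and `n` are finite): convergence means `Φ X` converges for every `X`, entry by entry. -/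
noncomputable instance superOpTopology (m n : Type*) : TopologicalSpace (SuperOp m n) :=
  TopologicalSpace.induced (fun (Φ : SuperOp m n) (X : Matrix m m ℂ) => Φ X) inferInstance

/-- The super-operator `Φ ⊗ id` on `L(H ⊗ H')`, with `H' = ℂ^r`: it applies `Φ` to each of the
blocks `(p, q) ↦ X (p, a) (q, b)` of `X`. -/
noncomputable def ampliation {m n : Type*} (r : Type*) (Φ : SuperOp m n) : SuperOp (m × r) (n × r) where
  toFun X := Matrix.of fun i j => Φ (Matrix.of fun p q => X (p, i.2) (q, j.2)) i.1 j.1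
  map_add' X Y := by
    ext i j
    exact congrFun (congrFun (Φ.map_add (Matrix.of fun p q => X (p, i.2) (q, j.2))
      (Matrix.of fun p q => Y (p, i.2) (q, j.2))) i.1) j.1
  map_smul' c X := by
    ext i j
    exact congrFun (congrFun (Φ.map_smul c (Matrix.of fun p q => X (p, i.2) (q, j.2))) i.1) j.1

/-- On product operators, `(Φ ⊗ id) (A ⊗ B) = Φ A ⊗ B`. -/
theorem ampliation_kronecker {m n r : Type*} (Φ : SuperOp m n) (A : Matrix m m ℂ)
    (B : Matrix r r ℂ) : ampliation r Φ (A ⊗ₖ B) = Φ A ⊗ₖ B := by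
  ext i j
  have h : (Matrix.of fun p q => (A ⊗ₖ B) (p, i.2) (q, j.2)) = B i.2 j.2 • A := by
    ext p q
    simp [mul_comm]
  change Φ (Matrix.of fun p q => (A ⊗ₖ B) (p, i.2) (q, j.2)) i.1 j.1 = _
  rw [h, map_smul]
  simp [mul_comm]

/-- Quantum channels: trace-preserving, completely positive super-operators. -/
structure IsChannel {m n : Type*} [Fintype m] [Fintype n] (Φ : SuperOp m n) : Prop where
  trace_preserving : ∀ X : Matrix m m ℂ, (Φ X).trace = X.trace
  completely_positive : ∀ (k : ℕ), 1 ≤ k → ∀ X : Matrix (m × Fin k) (m × Fin k) ℂ,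
    X.PosSemidef → (ampliation (Fin k) Φ X).PosSemidef

/-- Density operators: positive operators of trace one. -/
structure IsDensity {m : Type*} [Fintype m] (ρ : Matrix m m ℂ) : Prop where
  posSemidef : ρ.PosSemidef
  trace_eq_one : ρ.trace = 1

/-- The trace norm `‖X‖₁ = Tr |X|`, with `|X| = √(X† X)`. -/
noncomputable def traceNorm {m : Type*} [Fintype m] [DecidableEq m] (X : Matrix m m ℂ) : ℝ :=
  (CFC.sqrt (X.conjTranspose * X)).trace.re

/-- The trace distance `‖ρ - σ‖₁` between two operators. -/
noncomputable def traceDist {m : Type*} [Fintype m] [DecidableEq m] (ρ σ : Matrix m m ℂ) : ℝ :=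
  traceNorm (ρ - σ)

variable {m n : Type*} [Fintype m] [DecidableEq m] [Fintype n] [DecidableEq n]

/-- The values `‖(Φ ⊗ id_k) X‖₁`, for `k ≥ 1` and `X` in the unit ball of the trace norm. -/
def diamondValues (Φ : SuperOp m n) : Set ℝ :=
  {r | ∃ k : ℕ, 1 ≤ k ∧ ∃ X : Matrix (m × Fin k) (m × Fin k) ℂ,
    traceNorm X ≤ 1 ∧ r = traceNorm (ampliation (Fin k) Φ X)}

/-- The diamond norm (completely bounded trace norm). -/
noncomputable def diamondNorm (Φ : SuperOp m n) : ℝ := sSup (diamondValues Φ)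

/-- The distance `D(Φ₀, Φ₁; ρ)` of the outputs of two channels, for the joint input state `ρ` of
the system and an auxiliary system of dimension `k`. -/
noncomputable def distAt (Φ₀ Φ₁ : SuperOp m n) {k : ℕ}
    (ρ : Matrix (m × Fin k) (m × Fin k) ℂ) : ℝ :=
  traceDist (ampliation (Fin k) Φ₀ ρ) (ampliation (Fin k) Φ₁ ρ)

/-- The values `D(Φ₀, Φ₁; ρ)`, for `Φ₀ ∈ C₀` and `Φ₁ ∈ C₁`. -/
def distAtValues (C₀ C₁ : Set (SuperOp m n)) {k : ℕ}
    (ρ : Matrix (m × Fin k) (m × Fin k) ℂ) : Set ℝ :=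
  {r | ∃ Φ₀ ∈ C₀, ∃ Φ₁ ∈ C₁, r = distAt Φ₀ Φ₁ ρ}

/-- The distance of `C₀` and `C₁` with input state `ρ`. -/
noncomputable def setDistAt (C₀ C₁ : Set (SuperOp m n)) {k : ℕ}
    (ρ : Matrix (m × Fin k) (m × Fin k) ℂ) : ℝ :=
  sInf (distAtValues C₀ C₁ ρ)

/-- The distances of `C₀` and `C₁` with input state `ρ`, for all density operators `ρ` of the
system and an auxiliary system of any finite dimension. -/
def operationalValues (C₀ C₁ : Set (SuperOp m n)) : Set ℝ :=
  {r | ∃ (k : ℕ) (ρ : Matrix (m × Fin k) (m × Fin k) ℂ), IsDensity ρ ∧ r = setDistAt C₀ C₁ ρ}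

/-- The operational trace distance of `C₀` and `C₁`: supremum over inputs, then minimum over
channels. -/
noncomputable def operationalDist (C₀ C₁ : Set (SuperOp m n)) : ℝ :=
  sSup (operationalValues C₀ C₁)

/-- The values `‖Φ₀ - Φ₁‖_⋄`, for `Φ₀ ∈ C₀` and `Φ₁ ∈ C₁`. -/
def ordinaryValues (C₀ C₁ : Set (SuperOp m n)) : Set ℝ :=
  {r | ∃ Φ₀ ∈ C₀, ∃ Φ₁ ∈ C₁, r = diamondNorm (Φ₀ - Φ₁)}

/-- The ordinary trace distance of `C₀` and `C₁`. -/
noncomputable def ordinaryDist (C₀ C₁ : Set (SuperOp m n)) : ℝ :=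
  sInf (ordinaryValues C₀ C₁)

end ChannelDistance

/-! One inequality is weak duality: the minimum at a fixed input is at most the diamond distance of
the best pair of channels. The converse is a minimax argument in which the set of inputs is
effectively convex.

For a fixed input `ρ`, the output distance is convex and lower semicontinuous in the pair of
channels, being a supremum of functionals `Φ ↦ Re Tr ((Φ ⊗ id) ρ * T)` over `-1 ≤ T ≤ 1`
(`convexOn_distAt`, `lowerSemicontinuousOn_distAt`). If `a < D`, every pair is separated by more
than `a` at some input. Compactness and Hahn–Banach then give finitely many inputs and weights for
which the averaged distance is at least `a` for all pairs at once
(`exists_weights_of_forall_exists_lt`). A block-diagonal input, whose auxiliary system records the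
index, realizes this average exactly (`exists_isDensity_distAt_eq_sum`), so a single input works for
all pairs.

The diamond norm allows arbitrary `X`, while the operational distance allows only states. For
differences of channels the two suprema agree (`isLUB_distAt`): `X` is replaced by a Hermitian 2 × 2
block matrix, which is split into positive parts. -/

/-- A lower semicontinuous family of convex functions on a compact convex set, whose pointwise
supremum exceeds `a`, has a finite convex combination that is at least `a`. -/
theorem exists_weights_of_forall_exists_lt {E ι : Type*} [TopologicalSpace E] [AddCommGroup E]
    [Module ℝ E] {C : Set E} (hne : C.Nonempty) (hC : IsCompact C) (hconv : Convex ℝ C)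
    {F : ι → E → ℝ} (hF : ∀ i, ConvexOn ℝ C (F i)) (hlsc : ∀ i, LowerSemicontinuousOn (F i) C)
    {a : ℝ} (ha : ∀ x ∈ C, ∃ i, a < F i x) :
    ∃ (t : Finset ι) (w : t → ℝ), (∀ i, 0 ≤ w i) ∧ ∑ i, w i = 1 ∧
      ∀ x ∈ C, a ≤ ∑ i, w i * F i x := by
  classical
  obtain ⟨x₀, hx₀⟩ := hne
  have : Nonempty ι := ⟨(ha x₀ hx₀).choose⟩
  choose! f hf using ha
  -- Semicontinuity makes each strict inequality persist near its point within `C`, so finitely many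
  -- indices suffice.
  obtain ⟨t, htC, ht⟩ := hC.elim_nhdsWithin_subcover (fun x => {y | a < F (f x) y})
    (fun x hx => hlsc (f x) x hx a (hf x hx))
  let s : Finset ι := t.image f
  have hs : ∀ x ∈ C, ∃ i : s, a < F i x := by
    intro x hx
    obtain ⟨y, hy, hxy⟩ := Set.mem_iUnion₂.1 (ht hx)
    exact ⟨⟨f y, Finset.mem_image_of_mem f hy⟩, hxy⟩
  -- The separation takes place in the finite-dimensional space `s → ℝ`, so the topology of `E` need
  -- not be compatible with its linear structure. Passing from the image of `F` to its upward
  -- closure makes `S` convex.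
  let S : Set (s → ℝ) := {v | ∃ x ∈ C, ∀ i : s, F i x ≤ v i}
  let T : Set (s → ℝ) := {v | ∀ i, v i < a}
  have hSconv : Convex ℝ S := by
    rintro v ⟨x, hx, hv⟩ v' ⟨x', hx', hv'⟩ p q hp hq hpq
    refine ⟨p • x + q • x', hconv hx hx' hp hq hpq, fun i => ?_⟩
    refine ((hF i).2 hx hx' hp hq hpq).trans ?_
    simp only [smul_eq_mul, Pi.add_apply, Pi.smul_apply]
    gcongr
    · exact hv i
    · exact hv' i
  have hTpi : T = Set.univ.pi fun _ : s => Set.Iio a := by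
    ext v
    simp [T]
  have hTconv : Convex ℝ T := hTpi ▸ convex_pi fun _ _ => convex_Iio a
  have hTopen : IsOpen T := hTpi ▸ isOpen_set_pi Set.finite_univ fun _ _ => isOpen_Iio
  have hdisj : Disjoint T S := by
    rw [Set.disjoint_left]
    rintro v hvT ⟨x, hx, hv⟩
    obtain ⟨i, hi⟩ := hs x hx
    exact absurd (hvT i) (not_lt.2 (hi.le.trans (hv i)))
  obtain ⟨g, u, hgT, hgS⟩ := geometric_hahn_banach_open hTconv hTopen hSconv hdisj
  have hg : ∀ v, g v = ∑ i, g (Pi.single i 1) * v i := by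
    intro v
    conv_lhs => rw [pi_eq_sum_univ' v, map_sum]
    simp only [map_smul, smul_eq_mul, mul_comm]
  set c : s → ℝ := fun i => g (Pi.single i 1) with hc
  have hval : ∀ x ∈ C, u ≤ ∑ i, c i * F i x := by
    intro x hx
    have := hgS (fun i => F i x) ⟨x, hx, fun _ => le_rfl⟩
    rwa [hg] at this
  -- `S` is stable under increasing a coordinate. If `c i < 0`, the multiple of the basis vector
  -- used below brings `g` down to exactly `u - 1`, contradicting `u ≤ g` on `S`.
  have hc0 : ∀ i, 0 ≤ c i := by
    intro i
    by_contra! hi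
    set v₀ : s → ℝ := fun i => F i x₀ with hv₀
    have hmem : ∀ l : ℝ, 0 ≤ l → v₀ + l • Pi.single i 1 ∈ S := fun l hl => by
      refine ⟨x₀, hx₀, fun j => ?_⟩
      have : 0 ≤ l * (Pi.single i 1 : s → ℝ) j :=
        mul_nonneg hl (by by_cases h : j = i <;> simp [h])
      simpa [hv₀] using this
    have h0 : u ≤ g v₀ := hgS _ ⟨x₀, hx₀, fun _ => le_rfl⟩
    have h1 := hgS _ (hmem ((g v₀ - u + 1) / (-c i)) (div_nonneg (by linarith) (by linarith)))
    rw [map_add, map_smul, smul_eq_mul] at h1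
    change u ≤ g v₀ + (g v₀ - u + 1) / (-c i) * c i at h1
    have h2 : (g v₀ - u + 1) / (-c i) * c i = -(g v₀ - u + 1) := by
      field_simp [hi.ne]
    linarith
  -- The constant vectors with value `b < a` lie in `T`; let `b` tend to `a`.
  have hau : a * ∑ i, c i ≤ u := by
    have h : ∀ b < a, b * ∑ i, c i < u := by
      intro b hb
      have := hgT (fun _ => b) (fun _ => hb)
      rwa [hg, ← Finset.sum_mul, mul_comm] at this
    have hcl : a ∈ closure (Set.Iio a) := by simp
    exact closure_minimal (s := Set.Iio a) (t := {b | b * ∑ i, c i ≤ u}) (fun b hb => (h b hb).le)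
      (isClosed_le (by fun_prop) continuous_const) hcl
  -- Otherwise `g = 0`, and the separation would give both `0 < u` and `u ≤ 0`.
  have hpos : 0 < ∑ i, c i := by
    refine (Finset.sum_nonneg fun i _ => hc0 i).lt_of_ne fun h0 => ?_
    have hz : ∀ i, c i = 0 := fun i =>
      (Finset.sum_eq_zero_iff_of_nonneg fun i _ => hc0 i).1 h0.symm i (Finset.mem_univ i)
    have h1 := hgT (fun _ => a - 1) (fun _ => by simp)
    have h2 := hval x₀ hx₀
    rw [hg] at h1
    simp only [hz, zero_mul, Finset.sum_const_zero] at h1 h2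
    change ∑ i, c i * (a - 1) < u at h1
    simp only [hz, zero_mul, Finset.sum_const_zero] at h1
    linarith
  refine ⟨s, fun i => c i / ∑ i, c i, fun i => div_nonneg (hc0 i) hpos.le, ?_, fun x hx => ?_⟩
  · rw [← Finset.sum_div, div_self hpos.ne']
  · have : ∑ i, c i / (∑ i, c i) * F i x = (∑ i, c i * F i x) / ∑ i, c i := by
      rw [Finset.sum_div]
      exact Finset.sum_congr rfl fun i _ => by ring
    rw [this, le_div_iff₀ hpos]
    exact hau.trans (hval x hx)

namespace ChannelDistance
open Matrix

/-! ### Trace norm: computation, block matrices and duality -/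

section TraceNorm

variable {m n : Type*} [Fintype m] [DecidableEq m] [Fintype n] [DecidableEq n]

/-- By uniqueness of the positive square root, a trace norm can be computed by exhibiting any
positive `P` with the right square. -/
theorem traceNorm_eq_of_mul_self {X P : Matrix m m ℂ} (hP : P.PosSemidef) (h : P * P = Xᴴ * X) :
    traceNorm X = P.trace.re := by
  rw [traceNorm, CFC.sqrt_unique h hP.nonneg]

theorem exists_posSemidef_mul_self (X : Matrix m m ℂ) : ∃ P : Matrix m m ℂ, P.PosSemidef ∧
    P * P = Xᴴ * X :=
  ⟨CFC.sqrt (Xᴴ * X), nonneg_iff_posSemidef.1 (CFC.sqrt_nonneg _),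
    CFC.sqrt_mul_sqrt_self _ (posSemidef_conjTranspose_mul_self X).nonneg⟩

theorem traceNorm_nonneg (X : Matrix m m ℂ) : 0 ≤ traceNorm X := by
  obtain ⟨P, hP, h⟩ := exists_posSemidef_mul_self X
  rw [traceNorm_eq_of_mul_self hP h]
  exact (Complex.nonneg_iff.1 hP.trace_nonneg).1

theorem traceNorm_of_posSemidef {P : Matrix m m ℂ} (hP : P.PosSemidef) :
    traceNorm P = P.trace.re :=
  traceNorm_eq_of_mul_self hP (by rw [hP.isHermitian.eq])

theorem traceNorm_zero : traceNorm (0 : Matrix m m ℂ) = 0 := by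
  rw [traceNorm_of_posSemidef .zero]; simp

theorem traceNorm_smul {c : ℝ} (hc : 0 ≤ c) (X : Matrix m m ℂ) :
    traceNorm (c • X) = c * traceNorm X := by
  obtain ⟨P, hP, h⟩ := exists_posSemidef_mul_self X
  rw [traceNorm_eq_of_mul_self hP h, traceNorm_eq_of_mul_self (P := c • P) (hP.smul hc)]
  · simp [trace_smul]
  · simp [h, conjTranspose_smul]

theorem traceNorm_submatrix (e : n ≃ m) (X : Matrix m m ℂ) :
    traceNorm (X.submatrix e e) = traceNorm X := by
  obtain ⟨P, hP, h⟩ := exists_posSemidef_mul_self X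
  rw [traceNorm_eq_of_mul_self hP h, traceNorm_eq_of_mul_self (P := P.submatrix e e)
    (hP.submatrix e)]
  · simp only [trace, diag_apply, submatrix_apply]
    rw [Equiv.sum_comp e fun i => P i i]
  · rw [conjTranspose_submatrix, submatrix_mul_equiv, submatrix_mul_equiv, h]

theorem posSemidef_blockDiagonal' {ι : Type*} [Fintype ι] [DecidableEq ι] {r : ι → Type*}
    [∀ i, Fintype (r i)] [∀ i, DecidableEq (r i)] {P : ∀ i, Matrix (r i) (r i) ℂ}
    (hP : ∀ i, (P i).PosSemidef) : (blockDiagonal' P).PosSemidef := by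
  choose B hB using fun i => CStarAlgebra.nonneg_iff_eq_star_mul_self.1 (hP i).nonneg
  have : blockDiagonal' P = (blockDiagonal' B)ᴴ * blockDiagonal' B := by
    rw [blockDiagonal'_conjTranspose, ← blockDiagonal'_mul]
    congr 1
    funext i
    exact hB i
  rw [this]
  exact posSemidef_conjTranspose_mul_self _

theorem traceNorm_blockDiagonal' {ι : Type*} [Fintype ι] [DecidableEq ι] {r : ι → Type*}
    [∀ i, Fintype (r i)] [∀ i, DecidableEq (r i)] (X : ∀ i, Matrix (r i) (r i) ℂ) :
    traceNorm (blockDiagonal' X) = ∑ i, traceNorm (X i) := by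
  choose P hP h using fun i => exists_posSemidef_mul_self (X i)
  rw [traceNorm_eq_of_mul_self (posSemidef_blockDiagonal' hP), trace_blockDiagonal', Complex.re_sum]
  · exact Finset.sum_congr rfl fun i _ => (traceNorm_eq_of_mul_self (hP i) (h i)).symm
  · rw [← blockDiagonal'_mul, blockDiagonal'_conjTranspose, ← blockDiagonal'_mul]
    simp only [h]

/-- The spectrum is finite; this admits the discontinuous sign function into the functional
calculus. -/
theorem continuousOn_spectrum (A : Matrix m m ℂ) (f : ℝ → ℝ) : ContinuousOn f (spectrum ℝ A) :=
  A.finite_real_spectrum.continuousOn f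

/-- `X * Xᴴ` and `Xᴴ * X` have the same characteristic polynomial, hence the same eigenvalues, and
so do their square roots. -/
theorem traceNorm_conjTranspose (X : Matrix m m ℂ) : traceNorm Xᴴ = traceNorm X := by
  have hA : (Xᴴᴴ * Xᴴ).PosSemidef := posSemidef_conjTranspose_mul_self Xᴴ
  have hB : (Xᴴ * X).PosSemidef := posSemidef_conjTranspose_mul_self X
  have heig : hA.isHermitian.eigenvalues = hB.isHermitian.eigenvalues := by
    rw [IsHermitian.eigenvalues_eq_eigenvalues_iff, conjTranspose_conjTranspose, charpoly_mul_comm]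
  rw [traceNorm, traceNorm, CFC.sqrt_eq_real_sqrt _ hA.nonneg, CFC.sqrt_eq_real_sqrt _ hB.nonneg,
    cfcₙ_eq_cfc, cfcₙ_eq_cfc, trace_eq_neg_charpoly_nextCoeff, trace_eq_neg_charpoly_nextCoeff,
    hA.isHermitian.charpoly_cfc_eq, hB.isHermitian.charpoly_cfc_eq, heig]

/-- The square of this Hermitian matrix is block diagonal, with blocks `X * Xᴴ` and `Xᴴ * X`. It
reduces trace norms of general operators to Hermitian ones. -/
theorem traceNorm_fromBlocks_zero (X : Matrix m m ℂ) :
    traceNorm (fromBlocks 0 X Xᴴ 0) = 2 * traceNorm X := by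
  obtain ⟨P, hP, h⟩ := exists_posSemidef_mul_self X
  obtain ⟨Q, hQ, h'⟩ := exists_posSemidef_mul_self Xᴴ
  have htr : (fromBlocks Q 0 0 P).trace = Q.trace + P.trace := by
    simp [trace, Fintype.sum_sum_type]
  rw [traceNorm_eq_of_mul_self (P := fromBlocks Q 0 0 P), htr, Complex.add_re,
    ← traceNorm_eq_of_mul_self hP h, ← traceNorm_eq_of_mul_self hQ h', traceNorm_conjTranspose,
    two_mul]
  · obtain ⟨B, hB⟩ := CStarAlgebra.nonneg_iff_eq_star_mul_self.1 hP.nonneg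
    obtain ⟨B', hB'⟩ := CStarAlgebra.nonneg_iff_eq_star_mul_self.1 hQ.nonneg
    have : fromBlocks Q 0 0 P = (fromBlocks B' 0 0 B)ᴴ * fromBlocks B' 0 0 B := by
      simp [fromBlocks_conjTranspose, fromBlocks_multiply, hB, hB', star_eq_conjTranspose]
    rw [this]
    exact posSemidef_conjTranspose_mul_self _
  · simp [fromBlocks_conjTranspose, fromBlocks_multiply, h, h']

theorem trace_mul_re_nonneg {P R : Matrix m m ℂ} (hP : P.PosSemidef) (hR : R.PosSemidef) :
    0 ≤ (P * R).trace.re := by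
  obtain ⟨B, rfl⟩ := CStarAlgebra.nonneg_iff_eq_star_mul_self.1 hP.nonneg
  rw [star_eq_conjTranspose, mul_assoc, trace_mul_comm]
  exact (Complex.nonneg_iff.1 (hR.mul_mul_conjTranspose_same B).trace_nonneg).1

/-- Jordan decomposition, with `|A| = A⁺ + A⁻`. -/
theorem exists_posSemidef_sub {A : Matrix m m ℂ} (hA : A.IsHermitian) :
    ∃ P Q : Matrix m m ℂ, P.PosSemidef ∧ Q.PosSemidef ∧ A = P - Q ∧
      traceNorm A = P.trace.re + Q.trace.re := by
  have hsa : IsSelfAdjoint A := hA.isSelfAdjoint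
  refine ⟨A⁺, A⁻, nonneg_iff_posSemidef.1 (CFC.posPart_nonneg A),
    nonneg_iff_posSemidef.1 (CFC.negPart_nonneg A), (CFC.posPart_sub_negPart A hsa).symm, ?_⟩
  rw [← Complex.add_re, ← trace_add, CFC.posPart_add_negPart A hsa]
  rfl

/-- The operators `T` with `-1 ≤ T ≤ 1` are the test operators for the trace norm of Hermitian
operators. -/
theorem trace_mul_re_le_traceNorm {A T : Matrix m m ℂ} (hA : A.IsHermitian)
    (h₁ : (1 - T).PosSemidef) (h₂ : (1 + T).PosSemidef) : (A * T).trace.re ≤ traceNorm A := by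
  obtain ⟨P, Q, hP, hQ, hPQ, h⟩ := exists_posSemidef_sub hA
  have h3 := trace_mul_re_nonneg hP h₁
  have h4 := trace_mul_re_nonneg hQ h₂
  rw [mul_sub, mul_one, trace_sub, Complex.sub_re] at h3
  rw [mul_add, mul_one, trace_add, Complex.add_re] at h4
  rw [h, hPQ, sub_mul, trace_sub, Complex.sub_re]
  linarith

/-- The optimal test operator is `T = sign A`, since `|A| = A * sign A`. -/
theorem exists_traceNorm_eq_trace_mul {A : Matrix m m ℂ} (hA : A.IsHermitian) :
    ∃ T : Matrix m m ℂ, (1 - T).PosSemidef ∧ (1 + T).PosSemidef ∧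
      traceNorm A = (A * T).trace.re := by
  have hsa : IsSelfAdjoint A := hA.isSelfAdjoint
  have hc := continuousOn_spectrum A
  let f : ℝ → ℝ := fun t => SignType.sign t
  have hf : ∀ t, -1 ≤ f t ∧ f t ≤ 1 := fun t => by
    rcases lt_trichotomy t 0 with h | h | h <;> simp [f, h]
  refine ⟨cfc f A, ?_, ?_, ?_⟩
  · rw [← nonneg_iff_posSemidef, ← cfc_one ℝ A hsa, ← cfc_sub _ _ A (hc _) (hc _)]
    exact cfc_nonneg fun t _ => by simpa using (hf t).2
  · rw [← nonneg_iff_posSemidef, ← cfc_one ℝ A hsa, ← cfc_add A _ _ (hc _) (hc _)]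
    exact cfc_nonneg fun t _ => by simpa using by linarith [(hf t).1]
  · have : CFC.abs A = A * cfc f A := by
      rw [CFC.abs_eq_cfc_norm A hsa]
      conv_rhs => enter [1]; rw [← cfc_id ℝ A hsa]
      rw [← cfc_mul _ _ A (hc _) (hc _)]
      refine cfc_congr fun t _ => ?_
      simp [f, self_mul_sign]
    rw [← this]
    rfl

theorem traceNorm_sub_le {A B : Matrix m m ℂ} (hA : A.IsHermitian) (hB : B.IsHermitian) :
    traceNorm (A - B) ≤ traceNorm A + traceNorm B := by
  obtain ⟨T, h₁, h₂, h⟩ := exists_traceNorm_eq_trace_mul (hA.sub hB)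
  have h3 := trace_mul_re_le_traceNorm hA h₁ h₂
  have h4 := trace_mul_re_le_traceNorm (T := -T) hB (by simpa using h₂)
    (by simpa [← sub_eq_add_neg] using h₁)
  rw [mul_neg, trace_neg, Complex.neg_re] at h4
  rw [h, sub_mul, trace_sub, Complex.sub_re]
  linarith

end TraceNorm


/-! ### Ampliations: blocks, continuity, positivity -/

section Ampliation

variable {m n : Type*}

theorem ampliation_submatrix {r r' : Type*} (f : r' → r) (Φ : SuperOp m n)
    (X : Matrix (m × r) (m × r) ℂ) :
    ampliation r' Φ (X.submatrix (Prod.map id f) (Prod.map id f)) =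
      (ampliation r Φ X).submatrix (Prod.map id f) (Prod.map id f) := rfl

theorem ampliation_sub {r : Type*} (Φ₀ Φ₁ : SuperOp m n) (X : Matrix (m × r) (m × r) ℂ) :
    ampliation r (Φ₀ - Φ₁) X = ampliation r Φ₀ X - ampliation r Φ₁ X := rfl

theorem ampliation_fromBlocks {r : Type*} (Φ : SuperOp m n) (A B C D : Matrix (m × r) (m × r) ℂ) :
    ampliation (r ⊕ r) Φ ((fromBlocks A B C D).submatrix (Equiv.prodSumDistrib m r r)
      (Equiv.prodSumDistrib m r r)) =
    (fromBlocks (ampliation r Φ A) (ampliation r Φ B) (ampliation r Φ C)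
      (ampliation r Φ D)).submatrix (Equiv.prodSumDistrib n r r) (Equiv.prodSumDistrib n r r) := by
  ext ⟨p, a | a⟩ ⟨q, b | b⟩ <;> rfl

/-- The distributivity of the product over a disjoint union, on the right. -/
def prodSigmaEquiv (m : Type*) {ι : Type*} (r : ι → Type*) : (m × Σ i, r i) ≃ Σ i, m × r i where
  toFun x := ⟨x.2.1, x.1, x.2.2⟩
  invFun x := (x.2.1, ⟨x.1, x.2.2⟩)

theorem ampliation_blockDiagonal' {ι : Type*} [DecidableEq ι] {r : ι → Type*} (Φ : SuperOp m n)
    (X : ∀ i, Matrix (m × r i) (m × r i) ℂ) :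
    ampliation (Σ i, r i) Φ ((blockDiagonal' X).submatrix (prodSigmaEquiv m r)
      (prodSigmaEquiv m r)) =
    (blockDiagonal' fun i => ampliation (r i) Φ (X i)).submatrix (prodSigmaEquiv n r)
      (prodSigmaEquiv n r) := by
  ext ⟨p, i, a⟩ ⟨q, j, b⟩
  change Φ (of fun p q => blockDiagonal' X ⟨i, p, a⟩ ⟨j, q, b⟩) p q =
    blockDiagonal' (fun i => ampliation (r i) Φ (X i)) ⟨i, p, a⟩ ⟨j, q, b⟩
  by_cases h : i = j
  · subst h
    simp only [blockDiagonal'_apply_eq]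
    rfl
  · simp only [blockDiagonal'_apply_ne _ _ _ h]
    change Φ 0 p q = 0
    simp

theorem continuous_ampliation {r : Type*} (X : Matrix (m × r) (m × r) ℂ) :
    Continuous fun Φ : SuperOp m n => ampliation r Φ X := by
  refine continuous_matrix fun i j => ?_
  have h : Continuous fun (Φ : SuperOp m n) (Y : Matrix m m ℂ) => Φ Y := continuous_induced_dom
  exact ((continuous_apply _).comp h).matrix_elem i.1 j.1

variable [Fintype m] [Fintype n]

theorem IsChannel.trace_ampliation {Φ : SuperOp m n} (hΦ : IsChannel Φ) {r : Type*} [Fintype r]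
    (X : Matrix (m × r) (m × r) ℂ) : (ampliation r Φ X).trace = X.trace := by
  simp only [trace, diag_apply, Fintype.sum_prod_type_right]
  exact Finset.sum_congr rfl fun a _ => hΦ.trace_preserving (of fun p q => X (p, a) (q, a))

theorem IsChannel.posSemidef_ampliation {Φ : SuperOp m n} (hΦ : IsChannel Φ) {r : Type*}
    [Fintype r] {P : Matrix (m × r) (m × r) ℂ} (hP : P.PosSemidef) :
    (ampliation r Φ P).PosSemidef := by
  -- Complete positivity is assumed only for `k ≥ 1`, so an empty auxiliary index is treated apart.
  rcases isEmpty_or_nonempty r with h | h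
  · rw [Subsingleton.elim (ampliation r Φ P) 0]
    exact .zero
  · let e := Fintype.equivFin r
    have h1 := (hΦ.completely_positive _ (Fintype.card_pos (α := r)) _
      (hP.submatrix (Prod.map id e.symm))).submatrix (Prod.map id e)
    rw [← ampliation_submatrix, submatrix_submatrix] at h1
    have : Prod.map id e.symm ∘ Prod.map id e = (id : m × r → m × r) := by
      ext x <;> simp
    rwa [this, submatrix_id_id] at h1

theorem IsChannel.isHermitian_ampliation [DecidableEq m] {Φ : SuperOp m n} (hΦ : IsChannel Φ)
    {r : Type*} [Fintype r] [DecidableEq r] {A : Matrix (m × r) (m × r) ℂ} (hA : A.IsHermitian) :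
    (ampliation r Φ A).IsHermitian := by
  obtain ⟨P, Q, hP, hQ, rfl, -⟩ := exists_posSemidef_sub hA
  rw [map_sub]
  exact (hΦ.posSemidef_ampliation hP).isHermitian.sub (hΦ.posSemidef_ampliation hQ).isHermitian

/-- The ampliation preserves Hermitian matrices; apply this with a doubled auxiliary system to the
block matrix of `X` and `Xᴴ`, and compare off-diagonal blocks. -/
theorem IsChannel.ampliation_conjTranspose [DecidableEq m] {Φ : SuperOp m n} (hΦ : IsChannel Φ)
    {r : Type*} [Fintype r] [DecidableEq r] (X : Matrix (m × r) (m × r) ℂ) :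
    ampliation r Φ Xᴴ = (ampliation r Φ X)ᴴ := by
  have hA : (fromBlocks 0 X Xᴴ 0).IsHermitian := by
    simp [IsHermitian, fromBlocks_conjTranspose]
  have h := hΦ.isHermitian_ampliation (hA.submatrix (Equiv.prodSumDistrib m r r))
  rw [ampliation_fromBlocks, isHermitian_submatrix_equiv, isHermitian_fromBlocks_iff] at h
  exact h.2.1.symm

end Ampliation

/-! ### Input states and reduction of the diamond norm to them -/

section Inputs

variable {m n : Type*} [Fintype m] [DecidableEq m] [Fintype n] [DecidableEq n]

theorem IsDensity.traceNorm_eq_one {ρ : Matrix m m ℂ} (hρ : IsDensity ρ) : traceNorm ρ = 1 := by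
  rw [traceNorm_of_posSemidef hρ.posSemidef, hρ.trace_eq_one, Complex.one_re]

theorem IsDensity.submatrix {m n : Type*} [Fintype m] [Fintype n]
    {ρ : Matrix m m ℂ} (hρ : IsDensity ρ) (e : n ≃ m) :
    IsDensity (ρ.submatrix e e) where
  posSemidef := hρ.posSemidef.submatrix e
  trace_eq_one := by
    rw [← hρ.trace_eq_one]
    simp only [trace, diag_apply, submatrix_apply]
    exact Equiv.sum_comp e fun i => ρ i i

theorem exists_isDensity (m : Type*) [Fintype m] [DecidableEq m] [Nonempty m] :
    ∃ ρ : Matrix m m ℂ, IsDensity ρ := by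
  have i : m := Classical.arbitrary m
  refine ⟨diagonal (Pi.single i 1), .diagonal ?_, by simp [trace_diagonal]⟩
  exact Pi.single_nonneg.2 zero_le_one

/-- An input state with an arbitrary finite auxiliary index type is equivalent to one with the
auxiliary space `ℂ^k`. -/
theorem exists_isDensity_fin {m n : Type*} [Fintype m] [Fintype n] [DecidableEq n]
    {r : Type*} [Fintype r] [DecidableEq r]
    {ρ : Matrix (m × r) (m × r) ℂ} (hρ : IsDensity ρ) :
    ∃ (k : ℕ) (ρ' : Matrix (m × Fin k) (m × Fin k) ℂ), IsDensity ρ' ∧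
      ∀ Φ : SuperOp m n, traceNorm (ampliation (Fin k) Φ ρ') = traceNorm (ampliation r Φ ρ) := by
  let e := (Fintype.equivFin r).symm
  refine ⟨_, _, hρ.submatrix ((Equiv.refl m).prodCongr e), fun Φ => ?_⟩
  exact traceNorm_submatrix ((Equiv.refl n).prodCongr e) (ampliation r Φ ρ)

theorem distAt_eq {m n : Type*} [Fintype n] [DecidableEq n] (Φ₀ Φ₁ : SuperOp m n)
    {k : ℕ} (ρ : Matrix (m × Fin k) (m × Fin k) ℂ) :
    distAt Φ₀ Φ₁ ρ = traceNorm (ampliation (Fin k) (Φ₀ - Φ₁) ρ) := rfl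

theorem distAt_le_two {m n : Type*} [Fintype m] [Fintype n] [DecidableEq n]
    {Φ₀ Φ₁ : SuperOp m n} (h₀ : IsChannel Φ₀) (h₁ : IsChannel Φ₁) {k : ℕ}
    {ρ : Matrix (m × Fin k) (m × Fin k) ℂ} (hρ : IsDensity ρ) : distAt Φ₀ Φ₁ ρ ≤ 2 := by
  have h0 := h₀.posSemidef_ampliation hρ.posSemidef
  have h1 := h₁.posSemidef_ampliation hρ.posSemidef
  refine (traceNorm_sub_le h0.isHermitian h1.isHermitian).trans_eq ?_
  rw [traceNorm_of_posSemidef h0, traceNorm_of_posSemidef h1, h₀.trace_ampliation,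
    h₁.trace_ampliation, hρ.trace_eq_one]
  norm_num

/-- A bound for all input states bounds the completely bounded trace norm. -/
theorem le_of_mem_diamondValues {Φ₀ Φ₁ : SuperOp m n} (h₀ : IsChannel Φ₀) (h₁ : IsChannel Φ₁)
    {b : ℝ} (hb : 0 ≤ b) (hbound : ∀ (k : ℕ) (ρ : Matrix (m × Fin k) (m × Fin k) ℂ),
      IsDensity ρ → distAt Φ₀ Φ₁ ρ ≤ b) {x : ℝ} (hx : x ∈ diamondValues (Φ₀ - Φ₁)) : x ≤ b := by
  obtain ⟨k, -, X, hX, rfl⟩ := hx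
  set Φ := Φ₀ - Φ₁ with hΦ
  -- Doubling the auxiliary system makes room for the Hermitian block matrix built from `X`, whose
  -- norm is `2 * traceNorm X` and whose image has norm twice that of the image of `X`.
  let r := Fin k ⊕ Fin k
  -- Normalize `P` to a state; a positive operator of trace zero vanishes.
  have hpos : ∀ P : Matrix (m × r) (m × r) ℂ, P.PosSemidef →
      traceNorm (ampliation r Φ P) ≤ b * P.trace.re := by
    intro P hP
    have htr := Complex.nonneg_iff.1 hP.trace_nonneg
    rcases htr.1.eq_or_lt with h | h
    · have h0 : P.trace = 0 := Complex.ext h.symm htr.2.symm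
      rw [hP.trace_eq_zero_iff.1 h0, map_zero, traceNorm_zero]
      simp
    · have hρ : IsDensity ((P.trace.re)⁻¹ • P) := by
        refine ⟨hP.smul (inv_nonneg.2 h.le), ?_⟩
        rw [trace_smul]
        apply Complex.ext <;> simp [← htr.2, h.ne']
      obtain ⟨l, ρ', hρ', heq⟩ := exists_isDensity_fin (n := n) hρ
      have h1 := hbound l ρ' hρ'
      rw [distAt_eq, heq, LinearMap.map_smul_of_tower, traceNorm_smul (inv_nonneg.2 h.le),
        inv_mul_le_iff₀ h] at h1
      rwa [mul_comm]
  have hherm : ∀ A : Matrix (m × r) (m × r) ℂ, A.IsHermitian →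
      (ampliation r Φ A).IsHermitian := fun A hA =>
    (h₀.isHermitian_ampliation hA).sub (h₁.isHermitian_ampliation hA)
  have hstar : ampliation (Fin k) Φ Xᴴ = (ampliation (Fin k) Φ X)ᴴ := by
    rw [hΦ, ampliation_sub, ampliation_sub, h₀.ampliation_conjTranspose,
      h₁.ampliation_conjTranspose, conjTranspose_sub]
  let e := Equiv.prodSumDistrib m (Fin k) (Fin k)
  have hY : ((fromBlocks 0 X Xᴴ 0).submatrix e e).IsHermitian :=
    IsHermitian.submatrix (by simp [IsHermitian, fromBlocks_conjTranspose]) e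
  have hout : traceNorm (ampliation r Φ ((fromBlocks 0 X Xᴴ 0).submatrix e e)) =
      2 * traceNorm (ampliation (Fin k) Φ X) := by
    rw [ampliation_fromBlocks, hstar, map_zero, traceNorm_submatrix, traceNorm_fromBlocks_zero]
  have hin : traceNorm ((fromBlocks 0 X Xᴴ 0).submatrix e e) = 2 * traceNorm X := by
    rw [traceNorm_submatrix, traceNorm_fromBlocks_zero]
  obtain ⟨P, Q, hP, hQ, hPQ, htr⟩ := exists_posSemidef_sub hY
  have h2 := traceNorm_sub_le (hherm P hP.isHermitian) (hherm Q hQ.isHermitian)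
  rw [← map_sub, ← hPQ, hout] at h2
  rw [hin] at htr
  have h3 := hpos P hP
  have h4 := hpos Q hQ
  have h5 : b * (P.trace.re + Q.trace.re) ≤ b * 2 := mul_le_mul_of_nonneg_left (by linarith) hb
  linarith

end Inputs


/-! ### Distances of sets of channels and the minimax argument -/

section Distances

variable {m n : Type*} [Fintype m] [DecidableEq m] [Fintype n] [DecidableEq n]

/-- A flagged mixture of input states averages the output distances. -/
theorem exists_isDensity_distAt_eq_sum {ι : Type*} [Fintype ι] [DecidableEq ι] {k : ι → ℕ}
    {ρ : ∀ i, Matrix (m × Fin (k i)) (m × Fin (k i)) ℂ} (hρ : ∀ i, IsDensity (ρ i)) {w : ι → ℝ}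
    (hw : ∀ i, 0 ≤ w i) (hw1 : ∑ i, w i = 1) :
    ∃ (l : ℕ) (σ : Matrix (m × Fin l) (m × Fin l) ℂ), IsDensity σ ∧
      ∀ Φ₀ Φ₁ : SuperOp m n, distAt Φ₀ Φ₁ σ = ∑ i, w i * distAt Φ₀ Φ₁ (ρ i) := by
  -- The auxiliary spaces are joined as a direct sum, so their dimensions may differ. The flag
  -- survives the channels, and the trace norm is additive over the blocks.
  have h0 : IsDensity (blockDiagonal' fun i => w i • ρ i) := by
    refine ⟨posSemidef_blockDiagonal' fun i => (hρ i).posSemidef.smul (hw i), ?_⟩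
    simp only [trace_blockDiagonal', trace_smul, (hρ _).trace_eq_one]
    rw [← Finset.sum_smul, hw1, one_smul]
  obtain ⟨l, σ, hσ, h⟩ :=
    exists_isDensity_fin (n := n) (h0.submatrix (prodSigmaEquiv m fun i => Fin (k i)))
  refine ⟨l, σ, hσ, fun Φ₀ Φ₁ => ?_⟩
  rw [distAt_eq, h, ampliation_blockDiagonal', traceNorm_submatrix, traceNorm_blockDiagonal']
  refine Finset.sum_congr rfl fun i _ => ?_
  rw [LinearMap.map_smul_of_tower, traceNorm_smul (hw i), distAt_eq]

variable {C₀ C₁ : Set (SuperOp m n)}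

theorem isHermitian_ampliation_sub {m n : Type*} [Fintype m] [Fintype n] {Φ₀ Φ₁ : SuperOp m n}
    (h₀ : IsChannel Φ₀) (h₁ : IsChannel Φ₁) {k : ℕ}
    {ρ : Matrix (m × Fin k) (m × Fin k) ℂ} (hρ : IsDensity ρ) :
    (ampliation (Fin k) (Φ₀ - Φ₁) ρ).IsHermitian :=
  (h₀.posSemidef_ampliation hρ.posSemidef).isHermitian.sub
    (h₁.posSemidef_ampliation hρ.posSemidef).isHermitian

theorem convexOn_distAt {m n : Type*} [Fintype m] [Fintype n] [DecidableEq n]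
    {C₀ C₁ : Set (SuperOp m n)} (hconvex₀ : Convex ℝ C₀) (hconvex₁ : Convex ℝ C₁)
    (hchannel₀ : ∀ Φ ∈ C₀, IsChannel Φ) (hchannel₁ : ∀ Φ ∈ C₁, IsChannel Φ)
    {k : ℕ} {ρ : Matrix (m × Fin k) (m × Fin k) ℂ} (hρ : IsDensity ρ) :
    ConvexOn ℝ (C₀ ×ˢ C₁) fun Φ : SuperOp m n × SuperOp m n => distAt Φ.1 Φ.2 ρ := by
  have hconv := hconvex₀.prod hconvex₁
  refine ⟨hconv, fun Φ hΦ Ψ hΨ p q hp hq hpq => ?_⟩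
  have hmem := hconv hΦ hΨ hp hq hpq
  have hherm : ∀ Φ ∈ C₀ ×ˢ C₁, (ampliation (Fin k) (Φ.1 - Φ.2) ρ).IsHermitian := fun Φ hΦ =>
    isHermitian_ampliation_sub (hchannel₀ _ hΦ.1) (hchannel₁ _ hΦ.2) hρ
  -- The test operator optimal at the convex combination is admissible at both endpoints, and the
  -- functional it defines is linear.
  obtain ⟨T, h₁, h₂, h⟩ := exists_traceNorm_eq_trace_mul (hherm _ hmem)
  have hlin : ampliation (Fin k) ((p • Φ + q • Ψ).1 - (p • Φ + q • Ψ).2) ρ =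
      p • ampliation (Fin k) (Φ.1 - Φ.2) ρ + q • ampliation (Fin k) (Ψ.1 - Ψ.2) ρ := by
    have : (p • Φ + q • Ψ).1 - (p • Φ + q • Ψ).2 = p • (Φ.1 - Φ.2) + q • (Ψ.1 - Ψ.2) := by
      simp only [Prod.fst_add, Prod.snd_add, Prod.smul_fst, Prod.smul_snd, smul_sub]
      abel
    rw [this]
    rfl
  simp only [distAt_eq, smul_eq_mul]
  rw [h, hlin, add_mul, smul_mul, smul_mul, trace_add, trace_smul, trace_smul, Complex.add_re,
    Complex.smul_re, Complex.smul_re, smul_eq_mul, smul_eq_mul]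
  gcongr
  · exact trace_mul_re_le_traceNorm (hherm Φ hΦ) h₁ h₂
  · exact trace_mul_re_le_traceNorm (hherm Ψ hΨ) h₁ h₂

theorem lowerSemicontinuousOn_distAt {m n : Type*} [Fintype m] [Fintype n] [DecidableEq n]
    {C₀ C₁ : Set (SuperOp m n)}
    (hchannel₀ : ∀ Φ ∈ C₀, IsChannel Φ) (hchannel₁ : ∀ Φ ∈ C₁, IsChannel Φ)
    {k : ℕ} {ρ : Matrix (m × Fin k) (m × Fin k) ℂ} (hρ : IsDensity ρ) :
    LowerSemicontinuousOn (fun Φ : SuperOp m n × SuperOp m n => distAt Φ.1 Φ.2 ρ)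
      (C₀ ×ˢ C₁) := by
  intro Φ hΦ a ha
  have hherm : ∀ Φ ∈ C₀ ×ˢ C₁, (ampliation (Fin k) (Φ.1 - Φ.2) ρ).IsHermitian := fun Φ hΦ =>
    isHermitian_ampliation_sub (hchannel₀ _ hΦ.1) (hchannel₁ _ hΦ.2) hρ
  -- With `T` optimal at `Φ` held fixed, a continuous function bounds the distance from below and
  -- agrees with it at `Φ`.
  obtain ⟨T, h₁, h₂, h⟩ := exists_traceNorm_eq_trace_mul (hherm Φ hΦ)
  have hcont : Continuous fun Ψ : SuperOp m n × SuperOp m n =>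
      (ampliation (Fin k) (Ψ.1 - Ψ.2) ρ * T).trace.re := by
    have h0 := (continuous_ampliation (n := n) ρ).comp (continuous_fst (Y := SuperOp m n))
    have h1 := (continuous_ampliation (n := n) ρ).comp (continuous_snd (X := SuperOp m n))
    exact Complex.continuous_re.comp ((h0.sub h1).matrix_mul continuous_const).matrix_trace
  have ha' : a < (ampliation (Fin k) (Φ.1 - Φ.2) ρ * T).trace.re := h ▸ ha
  filter_upwards [(hcont.continuousAt.eventually (lt_mem_nhds ha')).filter_mono
    nhdsWithin_le_nhds, self_mem_nhdsWithin] with Ψ hΨ hmem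
  exact hΨ.trans_le (trace_mul_re_le_traceNorm (hherm Ψ hmem) h₁ h₂)

theorem isLUB_diamondValues [Nonempty m] {Φ₀ Φ₁ : SuperOp m n} (h₀ : IsChannel Φ₀)
    (h₁ : IsChannel Φ₁) : IsLUB (diamondValues (Φ₀ - Φ₁)) (diamondNorm (Φ₀ - Φ₁)) := by
  refine isLUB_csSup ⟨_, 1, le_rfl, 0, by simp [traceNorm_zero], rfl⟩ ⟨2, fun x hx => ?_⟩
  exact le_of_mem_diamondValues h₀ h₁ zero_le_two (fun k ρ hρ => distAt_le_two h₀ h₁ hρ) hx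

/-- The diamond distance of two channels is the supremum of the distances of the outputs. -/
theorem isLUB_distAt [Nonempty m] {Φ₀ Φ₁ : SuperOp m n} (h₀ : IsChannel Φ₀) (h₁ : IsChannel Φ₁) :
    IsLUB {x | ∃ (k : ℕ) (ρ : Matrix (m × Fin k) (m × Fin k) ℂ), IsDensity ρ ∧
      x = distAt Φ₀ Φ₁ ρ} (diamondNorm (Φ₀ - Φ₁)) := by
  constructor
  · rintro x ⟨k, ρ, hρ, rfl⟩
    refine (isLUB_diamondValues h₀ h₁).1 ⟨k, ?_, ρ, hρ.traceNorm_eq_one.le, rfl⟩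
    -- Operational inputs may have `k = 0`, but there the trace is an empty sum and cannot equal
    -- one.
    by_contra! hk
    obtain rfl : k = 0 := by omega
    have := hρ.trace_eq_one
    simp [trace] at this
  · intro b hb
    have hle : ∀ (k : ℕ) (ρ : Matrix (m × Fin k) (m × Fin k) ℂ), IsDensity ρ →
        distAt Φ₀ Φ₁ ρ ≤ b := fun k ρ hρ => hb ⟨k, ρ, hρ, rfl⟩
    -- A single state is needed to see that the upper bound `b` is nonnegative.
    obtain ⟨ρ, hρ⟩ := exists_isDensity (m × Fin 1)
    exact (isLUB_diamondValues h₀ h₁).2 fun x hx =>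
      le_of_mem_diamondValues h₀ h₁ ((traceNorm_nonneg _).trans (hle 1 ρ hρ)) hle hx

theorem isLeast_distAtValues {m n : Type*} [Fintype m] [Fintype n] [DecidableEq n]
    {C₀ C₁ : Set (SuperOp m n)} (hne₀ : C₀.Nonempty) (hne₁ : C₁.Nonempty)
    (hcompact₀ : IsCompact C₀) (hcompact₁ : IsCompact C₁)
    (hchannel₀ : ∀ Φ ∈ C₀, IsChannel Φ) (hchannel₁ : ∀ Φ ∈ C₁, IsChannel Φ)
    {k : ℕ} {ρ : Matrix (m × Fin k) (m × Fin k) ℂ} (hρ : IsDensity ρ) :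
    IsLeast (distAtValues C₀ C₁ ρ) (setDistAt C₀ C₁ ρ) := by
  obtain ⟨Φ, hΦ, hmin⟩ := (lowerSemicontinuousOn_distAt hchannel₀ hchannel₁ hρ).exists_isMinOn
    (hne₀.prod hne₁) (hcompact₀.prod hcompact₁)
  have h : IsLeast (distAtValues C₀ C₁ ρ) (distAt Φ.1 Φ.2 ρ) := by
    refine ⟨⟨Φ.1, hΦ.1, Φ.2, hΦ.2, rfl⟩, ?_⟩
    rintro x ⟨Ψ₀, hΨ₀, Ψ₁, hΨ₁, rfl⟩
    exact isMinOn_iff.1 hmin (Ψ₀, Ψ₁) ⟨hΨ₀, hΨ₁⟩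
  rwa [setDistAt, h.csInf_eq]

/-- A supremum of lower semicontinuous functions; this is enough for the minimum over a compact set
to be attained. -/
theorem lowerSemicontinuousOn_diamondNorm [Nonempty m]
    (hchannel₀ : ∀ Φ ∈ C₀, IsChannel Φ) (hchannel₁ : ∀ Φ ∈ C₁, IsChannel Φ) :
    LowerSemicontinuousOn (fun Φ : SuperOp m n × SuperOp m n => diamondNorm (Φ.1 - Φ.2))
      (C₀ ×ˢ C₁) := by
  intro Φ hΦ a ha
  obtain ⟨x, ⟨k, ρ, hρ, rfl⟩, hx⟩ :=
    (lt_isLUB_iff (isLUB_distAt (hchannel₀ _ hΦ.1) (hchannel₁ _ hΦ.2))).1 ha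
  filter_upwards [lowerSemicontinuousOn_distAt hchannel₀ hchannel₁ hρ Φ hΦ a hx,
    self_mem_nhdsWithin] with Ψ hΨ hmem
  exact hΨ.trans_le ((isLUB_distAt (hchannel₀ _ hmem.1) (hchannel₁ _ hmem.2)).1 ⟨k, ρ, hρ, rfl⟩)

theorem isLeast_ordinaryValues [Nonempty m] (hne₀ : C₀.Nonempty) (hne₁ : C₁.Nonempty)
    (hcompact₀ : IsCompact C₀) (hcompact₁ : IsCompact C₁)
    (hchannel₀ : ∀ Φ ∈ C₀, IsChannel Φ) (hchannel₁ : ∀ Φ ∈ C₁, IsChannel Φ) :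
    IsLeast (ordinaryValues C₀ C₁) (ordinaryDist C₀ C₁) := by
  obtain ⟨Φ, hΦ, hmin⟩ := (lowerSemicontinuousOn_diamondNorm hchannel₀ hchannel₁).exists_isMinOn
    (hne₀.prod hne₁) (hcompact₀.prod hcompact₁)
  have h : IsLeast (ordinaryValues C₀ C₁) (diamondNorm (Φ.1 - Φ.2)) := by
    refine ⟨⟨Φ.1, hΦ.1, Φ.2, hΦ.2, rfl⟩, ?_⟩
    rintro x ⟨Ψ₀, hΨ₀, Ψ₁, hΨ₁, rfl⟩
    exact isMinOn_iff.1 hmin (Ψ₀, Ψ₁) ⟨hΨ₀, hΨ₁⟩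
  rwa [ordinaryDist, h.csInf_eq]

theorem isLUB_operationalValues [Nonempty m] (hne₀ : C₀.Nonempty) (hne₁ : C₁.Nonempty)
    (hcompact₀ : IsCompact C₀) (hcompact₁ : IsCompact C₁)
    (hconvex₀ : Convex ℝ C₀) (hconvex₁ : Convex ℝ C₁)
    (hchannel₀ : ∀ Φ ∈ C₀, IsChannel Φ) (hchannel₁ : ∀ Φ ∈ C₁, IsChannel Φ) :
    IsLUB (operationalValues C₀ C₁) (ordinaryDist C₀ C₁) := by
  classical
  have hord := isLeast_ordinaryValues hne₀ hne₁ hcompact₀ hcompact₁ hchannel₀ hchannel₁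
  have hleast := fun {k : ℕ} {ρ : Matrix (m × Fin k) (m × Fin k) ℂ} (hρ : IsDensity ρ) =>
    isLeast_distAtValues hne₀ hne₁ hcompact₀ hcompact₁ hchannel₀ hchannel₁ hρ
  constructor
  · rintro x ⟨k, ρ, hρ, rfl⟩
    obtain ⟨Φ₀, hΦ₀, Φ₁, hΦ₁, h⟩ := hord.1
    rw [h]
    exact ((hleast hρ).2 ⟨Φ₀, hΦ₀, Φ₁, hΦ₁, rfl⟩).trans
      ((isLUB_distAt (hchannel₀ _ hΦ₀) (hchannel₁ _ hΦ₁)).1 ⟨k, ρ, hρ, rfl⟩)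
  · intro b hb
    refine le_of_forall_lt_imp_le_of_dense fun a ha => ?_
    -- The family in the minimax lemma is indexed by all input states, of every auxiliary dimension.
    let ι := {x : Σ k, Matrix (m × Fin k) (m × Fin k) ℂ // IsDensity x.2}
    obtain ⟨t, w, hw, hw1, h⟩ := exists_weights_of_forall_exists_lt (ι := ι) (hne₀.prod hne₁)
      (hcompact₀.prod hcompact₁) (hconvex₀.prod hconvex₁)
      (F := fun i Φ => distAt Φ.1 Φ.2 i.1.2)
      (fun i => convexOn_distAt hconvex₀ hconvex₁ hchannel₀ hchannel₁ i.2)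
      (fun i => lowerSemicontinuousOn_distAt hchannel₀ hchannel₁ i.2) (a := a) fun Φ hΦ => by
        have h1 : a < diamondNorm (Φ.1 - Φ.2) :=
          ha.trans_le (hord.2 ⟨Φ.1, hΦ.1, Φ.2, hΦ.2, rfl⟩)
        obtain ⟨x, ⟨k, ρ, hρ, rfl⟩, hx⟩ :=
          (lt_isLUB_iff (isLUB_distAt (hchannel₀ _ hΦ.1) (hchannel₁ _ hΦ.2))).1 h1
        exact ⟨⟨⟨k, ρ⟩, hρ⟩, hx⟩
    obtain ⟨l, σ, hσ, heq⟩ := exists_isDensity_distAt_eq_sum (n := n) (ι := t)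
      (ρ := fun i => i.1.1.2) (fun i => i.1.2) hw hw1
    refine le_trans ?_ (hb ⟨l, σ, hσ, rfl⟩)
    -- The weighted bound holds for every pair, in particular for the pair minimizing the distance
    -- at `σ`.
    obtain ⟨Φ₀, hΦ₀, Φ₁, hΦ₁, hval⟩ := (hleast hσ).1
    rw [hval, heq]
    exact h (Φ₀, Φ₁) (Set.mk_mem_prod hΦ₀ hΦ₁)

end Distances

end ChannelDistance

/-- The last conjunct is the equality of the two distances; the others say that every supremum and
minimum in their definitions exists: the diamond norms are finite, the minima are attained, and the
supremum over the input states is finite. -/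
theorem theorem1 {m n : Type*} [Fintype m] [DecidableEq m] [Nonempty m]
    [Fintype n] [DecidableEq n] (C₀ C₁ : Set (ChannelDistance.SuperOp m n))
    (hne₀ : C₀.Nonempty) (hne₁ : C₁.Nonempty)
    (hcompact₀ : IsCompact C₀) (hcompact₁ : IsCompact C₁)
    (hconvex₀ : Convex ℝ C₀) (hconvex₁ : Convex ℝ C₁)
    (hchannel₀ : ∀ Φ ∈ C₀, ChannelDistance.IsChannel Φ)
    (hchannel₁ : ∀ Φ ∈ C₁, ChannelDistance.IsChannel Φ) :
    (∀ Φ₀ ∈ C₀, ∀ Φ₁ ∈ C₁, IsLUB (ChannelDistance.diamondValues (Φ₀ - Φ₁))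
      (ChannelDistance.diamondNorm (Φ₀ - Φ₁))) ∧
    (∀ (k : ℕ) (ρ : Matrix (m × Fin k) (m × Fin k) ℂ), ChannelDistance.IsDensity ρ →
      IsLeast (ChannelDistance.distAtValues C₀ C₁ ρ) (ChannelDistance.setDistAt C₀ C₁ ρ)) ∧
    IsLUB (ChannelDistance.operationalValues C₀ C₁) (ChannelDistance.operationalDist C₀ C₁) ∧
    IsLeast (ChannelDistance.ordinaryValues C₀ C₁) (ChannelDistance.ordinaryDist C₀ C₁) ∧
    ChannelDistance.operationalDist C₀ C₁ = ChannelDistance.ordinaryDist C₀ C₁ := by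
  have hord := ChannelDistance.isLeast_ordinaryValues hne₀ hne₁ hcompact₀ hcompact₁
    hchannel₀ hchannel₁
  have hop := ChannelDistance.isLUB_operationalValues hne₀ hne₁ hcompact₀ hcompact₁
    hconvex₀ hconvex₁ hchannel₀ hchannel₁
  obtain ⟨ρ, hρ⟩ := ChannelDistance.exists_isDensity (m × Fin 1)
  have heq : ChannelDistance.operationalDist C₀ C₁ = ChannelDistance.ordinaryDist C₀ C₁ :=
    hop.csSup_eq ⟨_, 1, ρ, hρ, rfl⟩
  exact ⟨fun Φ₀ h₀ Φ₁ h₁ =>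
      ChannelDistance.isLUB_diamondValues (hchannel₀ Φ₀ h₀) (hchannel₁ Φ₁ h₁),
    fun k ρ hρ => ChannelDistance.isLeast_distAtValues hne₀ hne₁ hcompact₀ hcompact₁
      hchannel₀ hchannel₁ hρ,
    heq ▸ hop, hord, heq⟩
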